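/- Let $q$ be a prime power, let $k>1$ be an integer, put $\Delta=\frac{q^k-1}{q-1}$, and let $\gamma$ be a fixed primitive element of $\mathbb{F}_{q^k}$ (a generator of $\mathbb{F}_{q^k}^*$). For an integer $a$ let $h_a(x)\in\mathbb{F}_q[x]$ be the minimal polynomial of $\gamma^{-a}$ over $\mathbb{F}_q$. The parity-check polynomial of a cyclic code of length $n$ over $\mathbb{F}_q$ is $(x^n-1)/g(x)$, where the monic divisor $g(x)$ of $x^n-1$ is the generator polynomial of the code. Let $\mathcal{C}$ be a cyclic code of length $q^k-1$ over $\mathbb{F}_q$. Then $\mathcal{C}$ has the weight distribution - weight $0$: $1$ codeword, - weight $q^{k-1}(q-1)-1$: $(q-1)(q^k-1)$ codewords, - weight $q^{k-1}(q-1)$: $q^k-1$ codewords, - weight $q^k-1$: $q-1$ codewords, - and no codewords of any other Hamming weight, if and only if $\mathcal{C}$ has dimension $k+1$ and there exist integers $e_1,e_2$ such that $h_{\Delta e_1}(x)h_{e_2}(x)$ is the parity-check polynomial of $\mathcal{C}$, $\gcd(q-1,ke_1-e_2)=1$ and $\gcd(\Delta,e_2)=1$. -/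

import Mathlib

noncomputable section

/-- A linear code of length `n` over `F` is cyclic if it is closed under the circular shift
`(c₀, c₁, …, cₙ₋₁) ↦ (c₁, …, cₙ₋₁, c₀)`. -/
def IsCyclicCode {F : Type*} [Field F] {n : ℕ} (code : Submodule F (Fin n → F)) : Prop :=
  ∀ c ∈ code, c ∘ finRotate n ∈ code

/-- The polynomial `c₀ + c₁ x + ⋯ + cₙ₋₁ xⁿ⁻¹` of a word `c`. -/
def wordPolynomial {F : Type*} [Field F] {n : ℕ} (c : Fin n → F) : Polynomial F :=
  ∑ i : Fin n, Polynomial.monomial (i : ℕ) (c i)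

/-- `g` is the generator polynomial of `code`: it is a monic divisor of `xⁿ - 1`, and the words
of the code are those whose polynomial is a multiple of `g`. -/
def IsGeneratorPolynomial {F : Type*} [Field F] {n : ℕ} (code : Submodule F (Fin n → F))
    (g : Polynomial F) : Prop :=
  g.Monic ∧ g ∣ Polynomial.X ^ n - 1 ∧ ∀ c : Fin n → F, c ∈ code ↔ g ∣ wordPolynomial c

/-- `h` is the parity-check polynomial of `code`: `h = (xⁿ - 1) / g`, where `g` is the generator
polynomial. -/
def IsParityCheckPolynomial {F : Type*} [Field F] {n : ℕ} (code : Submodule F (Fin n → F))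
    (h : Polynomial F) : Prop :=
  ∃ g : Polynomial F, IsGeneratorPolynomial code g ∧ g * h = Polynomial.X ^ n - 1

/-- The number of words of Hamming weight `w` in `code`. -/
def weightFrequency {F : Type*} [Field F] [DecidableEq F] {n : ℕ}
    (code : Submodule F (Fin n → F)) (w : ℕ) : ℕ :=
  {c : Fin n → F | c ∈ code ∧ hammingNorm c = w}.ncard

/-- The three-weight distribution: one word of weight `0`, `(q-1)(q^k-1)` words of weight
`q^(k-1)(q-1)-1`, `q^k-1` words of weight `q^(k-1)(q-1)`, `q-1` words of weight `q^k-1`,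
and no word of any other weight. -/
def HasThreeWeightDistribution {F : Type*} [Field F] [DecidableEq F] {n : ℕ} (q k : ℕ)
    (code : Submodule F (Fin n → F)) : Prop :=
  weightFrequency code 0 = 1 ∧
  weightFrequency code (q ^ (k - 1) * (q - 1) - 1) = (q - 1) * (q ^ k - 1) ∧
  weightFrequency code (q ^ (k - 1) * (q - 1)) = q ^ k - 1 ∧
  weightFrequency code (q ^ k - 1) = q - 1 ∧
  ∀ w : ℕ, w ≠ 0 → w ≠ q ^ (k - 1) * (q - 1) - 1 → w ≠ q ^ (k - 1) * (q - 1) →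
    w ≠ q ^ k - 1 → weightFrequency code w = 0

/-- `Δ = (q^k - 1) / (q - 1)`; the division is exact. -/
def cyclicDelta (q k : ℕ) : ℕ := (q ^ k - 1) / (q - 1)

/-- `h_a(x)`, the minimal polynomial of `γ⁻ᵃ` over `F`. -/
def hPoly (F : Type*) {K : Type*} [Field F] [Field K] [Algebra F K] (γ : Kˣ) (a : ℤ) :
    Polynomial F :=
  minpoly F ((γ ^ (-a) : Kˣ) : K)

end

/-! Put n = q^k - 1 and let S be the right shift. The code with parity-check polynomial h is the
kernel of h(S), so both directions are linear algebra for S.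

From parity check to weights: with l = γ^(Δe₁) in F and x = γ^e₂, the words a l^i + Tr(b x^i) lie in
the code. Put θ = x/l. The gcd conditions say exactly that θ is primitive, because Δ ≡ k mod q - 1.
Up to the factor l^i an entry is a + Tr(bθ^i), and for b ≠ 0 the elements bθ^i exhaust the nonzero
elements of K. Fibre sizes of the trace give the weights, and the dimension shows that there are no
other words (`hasThreeWeightDistribution_of_eq_range_traceWord`).

From weights to parity check: the code has q^(k+1) words. The q - 1 words of full weight are the
multiples of one word u, hence u is an eigenvector of S. A translation preserving every support has
order dividing two consecutive weights, so it is trivial; hence the n functionals c ↦ c_i/u_i are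
distinct (`HasThreeWeightDistribution.eq_of_div_eq`). They lie among the q^k functionals with value
1 at u, so exactly one, φ, is missing. By uniqueness φ is an eigenvector for S, and W = ker φ is an
invariant complement of u. It is irreducible: a proper invariant U would let φ be perturbed to a
coordinate functional vanishing on U, forcing U = 0 (`exists_irreducible_complement`). So W is
killed by the minimal polynomial, of degree k, of some x in K. Distinctness of the functionals also
gives the coprimality. -/

open Polynomial

noncomputable section

/-- The right circular shift, which is multiplication by `X` modulo `X ^ n - 1`. -/
def rightShift (F : Type*) [Field F] (n : ℕ) [NeZero n] : Module.End F (Fin n → F) :=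
  LinearMap.funLeft F F fun i => i - 1

/-! ### Words as polynomials modulo X^n - 1, and kernels of polynomials in the shift. -/

section Words

variable {F : Type*} [Field F] {n : ℕ}

theorem wordPolynomial_add (c d : Fin n → F) :
    wordPolynomial (c + d) = wordPolynomial c + wordPolynomial d := by
  simp [wordPolynomial, Finset.sum_add_distrib]

theorem wordPolynomial_smul (a : F) (c : Fin n → F) :
    wordPolynomial (a • c) = C a * wordPolynomial c := by
  simp [wordPolynomial, Finset.mul_sum, C_mul_monomial]

theorem coeff_wordPolynomial (c : Fin n → F) (i : Fin n) :
    (wordPolynomial c).coeff i = c i := by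
  simp only [wordPolynomial, finsetSum_coeff, coeff_monomial]
  rw [Finset.sum_eq_single i] <;> simp +contextual [Fin.val_inj]

theorem degree_wordPolynomial_lt_of_forall_eq_zero (c : Fin n → F) {d : ℕ}
    (h : ∀ i : Fin n, d ≤ i → c i = 0) : (wordPolynomial c).degree < d := by
  rw [← mem_degreeLT, wordPolynomial]
  refine Submodule.sum_mem _ fun i _ => ?_
  rw [mem_degreeLT]
  by_cases hi : d ≤ i
  · simp [h i hi]
  · exact (degree_monomial_le _ _).trans_lt (by exact_mod_cast not_le.mp hi)

theorem degree_wordPolynomial_lt (c : Fin n → F) : (wordPolynomial c).degree < n :=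
  degree_wordPolynomial_lt_of_forall_eq_zero c fun i hi => absurd i.2 (not_lt.mpr hi)

theorem eq_zero_of_wordPolynomial_eq_zero {c : Fin n → F} (h : wordPolynomial c = 0) : c = 0 := by
  ext i
  rw [← coeff_wordPolynomial c, h, coeff_zero, Pi.zero_apply]

variable [NeZero n]

theorem rightShift_apply (c : Fin n → F) (i : Fin n) : rightShift F n c i = c (i - 1) := rfl

theorem pow_val_add_one {M : Type*} [Monoid M] {x : M} (hx : x ^ n = 1) (i : Fin n) :
    x ^ ((i + 1 : Fin n) : ℕ) = x ^ (i : ℕ) * x := by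
  rw [Fin.val_add, ← pow_eq_pow_mod _ hx, Fin.coe_ofNat_eq_mod, ← pow_succ]
  rw [pow_add, ← pow_eq_pow_mod _ hx, ← pow_add]

theorem rightShift_pow_apply (j : ℕ) (c : Fin n → F) (i : Fin n) :
    (rightShift F n ^ j) c i = c (i - Fin.ofNat n j) := by
  induction j generalizing i with
  | zero => simp
  | succ j ih =>
    rw [pow_succ', Module.End.mul_apply, rightShift_apply, ih]
    congr 1
    have : Fin.ofNat n (j + 1) = Fin.ofNat n j + 1 := by
      ext; simp [Fin.val_add]
    rw [this]; abel

theorem X_pow_sub_one_dvd_wordPolynomial_iff (c : Fin n → F) :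
    (X ^ n - 1 : F[X]) ∣ wordPolynomial c ↔ c = 0 := by
  constructor
  · intro h
    refine eq_zero_of_wordPolynomial_eq_zero (eq_zero_of_dvd_of_degree_lt h ?_)
    rw [← C_1, degree_X_pow_sub_C (NeZero.pos n)]
    exact degree_wordPolynomial_lt c
  · rintro rfl
    simp [wordPolynomial]

theorem X_pow_sub_one_dvd_wordPolynomial_rightShift_sub (c : Fin n → F) :
    (X ^ n - 1 : F[X]) ∣ wordPolynomial (rightShift F n c) - X * wordPolynomial c := by
  have h1 : wordPolynomial (rightShift F n c) =
      ∑ i : Fin n, monomial ((i + 1 : Fin n) : ℕ) (c i) := by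
    rw [wordPolynomial, ← Equiv.sum_comp (Equiv.addRight (1 : Fin n))]
    simp [rightShift_apply]
  rw [h1, wordPolynomial, Finset.mul_sum, ← Finset.sum_sub_distrib]
  refine Finset.dvd_sum fun i _ => ?_
  rw [X_mul_monomial, Fin.val_add_eq_ite]
  -- For n = 1 the element `1 : Fin n` has value 0, so the wrap-around formula needs a separate
  -- case.
  rcases Nat.lt_or_ge 1 n with hn | hn
  · have h1 : ((1 : Fin n) : ℕ) = 1 := by rw [Fin.coe_ofNat_eq_mod, Nat.mod_eq_of_lt hn]
    rw [h1]
    split_ifs with h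
    · have : (i : ℕ) + 1 = n := le_antisymm i.2 h
      rw [this, Nat.sub_self, ← C_mul_X_pow_eq_monomial, ← C_mul_X_pow_eq_monomial]
      exact ⟨-C (c i), by ring⟩
    · simp
  · obtain rfl : n = 1 := le_antisymm hn (NeZero.pos n)
    have : i = 0 := Subsingleton.elim _ _
    subst this
    simp only [Fin.isValue, Fin.val_zero, zero_add, ← C_mul_X_pow_eq_monomial]
    exact ⟨-C (c 0), by simp; ring⟩

theorem X_pow_sub_one_dvd_wordPolynomial_aeval_sub (p : F[X]) (c : Fin n → F) :
    (X ^ n - 1 : F[X]) ∣ wordPolynomial (aeval (rightShift F n) p c) - p * wordPolynomial c := by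
  induction p using Polynomial.induction_on generalizing c with
  | C a =>
    have : aeval (rightShift F n) (C a) c = a • c := by simp
    rw [this, wordPolynomial_smul, sub_self]
    exact dvd_zero _
  | add p r hp hr =>
    rw [map_add, LinearMap.add_apply, wordPolynomial_add]
    convert dvd_add (hp c) (hr c) using 1
    ring
  | monomial j a ih =>
    have : aeval (rightShift F n) (C a * X ^ (j + 1)) c =
        aeval (rightShift F n) (C a * X ^ j) (rightShift F n c) := by
      rw [pow_succ, ← mul_assoc, map_mul, aeval_X, Module.End.mul_apply]
    rw [this]
    convert dvd_add (ih (rightShift F n c)) (dvd_mul_of_dvd_right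
      (X_pow_sub_one_dvd_wordPolynomial_rightShift_sub c) (C a * X ^ j)) using 1
    ring

/-- Cancel h in gh ∣ h·w, where w is the polynomial of c; modulo X^n - 1 the product h·w represents
h(S)c. -/
theorem dvd_wordPolynomial_iff {g h : F[X]} (hgh : g * h = X ^ n - 1) (c : Fin n → F) :
    g ∣ wordPolynomial c ↔ aeval (rightShift F n) h c = 0 := by
  have h0 : h ≠ 0 := by
    rintro rfl
    rw [mul_zero] at hgh
    exact (monic_X_pow_sub_C (1 : F) (NeZero.ne n)).ne_zero (by rw [C_1, ← hgh])
  rw [← X_pow_sub_one_dvd_wordPolynomial_iff,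
    dvd_iff_dvd_of_dvd_sub (X_pow_sub_one_dvd_wordPolynomial_aeval_sub h c), ← hgh,
    mul_comm h, mul_dvd_mul_iff_right h0]

theorem aeval_rightShift_X_pow_sub_one : aeval (rightShift F n) (X ^ n - 1 : F[X]) = 0 := by
  ext1 c
  refine LinearMap.ext fun a => ?_
  simp only [LinearMap.comp_apply, LinearMap.zero_apply]
  rw [← dvd_wordPolynomial_iff (one_mul (X ^ n - 1 : F[X]))]
  exact one_dvd _

theorem finrank_ker_aeval_rightShift_le {h : F[X]} (hh : h ∣ X ^ n - 1) :
    Module.finrank F (LinearMap.ker (aeval (rightShift F n) h)) ≤ h.natDegree := by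
  obtain ⟨g, hg⟩ := hh
  have hX : (X ^ n - 1 : F[X]).natDegree = n := by rw [← C_1, natDegree_X_pow_sub_C]
  have hne : (X ^ n - 1 : F[X]) ≠ 0 := by
    rw [← C_1]; exact (monic_X_pow_sub_C (1 : F) (NeZero.ne n)).ne_zero
  have hg0 : g ≠ 0 := by rintro rfl; exact hne (by rw [hg, mul_zero])
  have hh0 : h ≠ 0 := by rintro rfl; exact hne (by rw [hg, zero_mul])
  have hdeg : h.natDegree + g.natDegree = n := by rw [← natDegree_mul hh0 hg0, ← hg, hX]
  -- Keep the top deg h coordinates. If they vanish, the word has degree below deg g but is a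
  -- multiple of g, hence is zero.
  let f : (Fin n → F) →ₗ[F] (Fin h.natDegree → F) :=
    LinearMap.funLeft F F fun i => ⟨g.natDegree + i, by omega⟩
  have hf : Function.Injective (f.comp (LinearMap.ker (aeval (rightShift F n) h)).subtype) := by
    rw [← LinearMap.ker_eq_bot, LinearMap.ker_eq_bot']
    rintro ⟨c, hc⟩ hfc
    rw [LinearMap.mem_ker, ← dvd_wordPolynomial_iff (by rw [hg, mul_comm])] at hc
    rw [Submodule.mk_eq_zero]
    refine eq_zero_of_wordPolynomial_eq_zero (eq_zero_of_dvd_of_degree_lt hc ?_)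
    rw [degree_eq_natDegree hg0]
    refine degree_wordPolynomial_lt_of_forall_eq_zero c fun i hi => ?_
    have := congrFun hfc ⟨i - g.natDegree, by omega⟩
    simp only [LinearMap.comp_apply, Submodule.subtype_apply, f, LinearMap.funLeft_apply,
      Pi.zero_apply] at this
    rw [← this]
    congr 1
    ext
    simp only []
    omega
  simpa using LinearMap.finrank_le_finrank_of_injective hf

/-- The left shift is injective on a finite code, hence surjective, so its inverse also preserves
the code. -/
theorem IsCyclicCode.rightShift_mem {code : Submodule F (Fin n → F)} [Finite F]
    (hcode : IsCyclicCode code) {c : Fin n → F} (hc : c ∈ code) : rightShift F n c ∈ code := by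
  have hinj : Function.Injective fun x : code => (⟨x.1 ∘ finRotate n, hcode _ x.2⟩ : code) := by
    intro x y hxy
    exact Subtype.ext ((finRotate n).surjective.injective_comp_right (congrArg Subtype.val hxy))
  obtain ⟨d, hd⟩ := Finite.surjective_of_injective hinj ⟨c, hc⟩
  convert d.2
  ext i
  obtain rfl : d.1 ∘ finRotate n = c := congrArg Subtype.val hd
  simp [rightShift_apply, finRotate_apply]

theorem IsParityCheckPolynomial.mem_iff {code : Submodule F (Fin n → F)} {h : F[X]}
    (hh : IsParityCheckPolynomial code h) (c : Fin n → F) :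
    c ∈ code ↔ aeval (rightShift F n) h c = 0 := by
  obtain ⟨g, ⟨_, _, hg⟩, hgh⟩ := hh
  rw [hg, dvd_wordPolynomial_iff hgh]

theorem isParityCheckPolynomial_of_mem_iff {code : Submodule F (Fin n → F)} {h : F[X]}
    (hm : h.Monic) (hdvd : h ∣ X ^ n - 1)
    (hh : ∀ c, c ∈ code ↔ aeval (rightShift F n) h c = 0) : IsParityCheckPolynomial code h := by
  obtain ⟨g, hg⟩ := hdvd
  have hX : (X ^ n - 1 : F[X]).Monic := by
    rw [← C_1]; exact monic_X_pow_sub_C (1 : F) (NeZero.ne n)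
  have hgh : g * h = X ^ n - 1 := by rw [hg, mul_comm]
  exact ⟨g, ⟨hm.of_mul_monic_left (hg ▸ hX), ⟨h, hgh.symm⟩, fun c => by
    rw [hh, dvd_wordPolynomial_iff hgh]⟩, hgh⟩

end Words

end

noncomputable section

/-! ### Orbit and fibre counts. -/

section Counting

/-- Z is a union of left cosets of the subgroup generated by s. -/
theorem orderOf_dvd_card_of_forall_mul_mem {G : Type*} [Group G] [Finite G] (s : G) (Z : Set G)
    (hZ : ∀ x ∈ Z, x * s ∈ Z) : orderOf s ∣ Nat.card Z := by
  have hpow : ∀ (j : ℕ), ∀ x ∈ Z, x * s ^ j ∈ Z := by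
    intro j
    induction j with
    | zero => simp
    | succ j ih => exact fun x hx => by simpa [pow_succ, mul_assoc] using hZ _ (ih x hx)
  have : QuotientGroup.mk ⁻¹' ((QuotientGroup.mk : G → G ⧸ Subgroup.zpowers s) '' Z) = Z := by
    refine Set.Subset.antisymm ?_ (Set.subset_preimage_image _ _)
    rintro y ⟨x, hx, hxy⟩
    obtain ⟨j, hj⟩ := (mem_powers_iff_mem_zpowers.mpr (QuotientGroup.eq.mp hxy))
    rw [show y = x * s ^ j by rw [show s ^ j = x⁻¹ * y from hj, mul_inv_cancel_left]]
    exact hpow j x hx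
  rw [← Nat.card_zpowers, ← this, QuotientGroup.card_preimage_mk]
  exact dvd_mul_right _ _

theorem addOrderOf_dvd_card_of_forall_add_mem {A : Type*} [AddGroup A] [Finite A] (s : A)
    (Z : Set A) (hZ : ∀ x ∈ Z, x + s ∈ Z) : addOrderOf s ∣ Nat.card Z :=
  orderOf_dvd_card_of_forall_mul_mem (G := Multiplicative A) (Multiplicative.ofAdd s) Z hZ

theorem LinearMap.card_fiber_eq_pow {F V : Type*} [Field F] [Finite F] [AddCommGroup V]
    [Module F V] [Module.Finite F V] (f : V →ₗ[F] F) (hf : Function.Surjective f) (t : F) :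
    Nat.card {v // f v = t} = Nat.card F ^ (Module.finrank F V - 1) := by
  obtain ⟨v₀, hv₀⟩ := hf t
  have e : {v // f v = t} ≃ LinearMap.ker f :=
    { toFun := fun v => ⟨v - v₀, by simp [v.2, hv₀]⟩
      invFun := fun v => ⟨v + v₀, by simp [hv₀]⟩
      left_inv := fun v => by simp
      right_inv := fun v => by simp }
  rw [Nat.card_congr e, Module.natCard_eq_pow_finrank (K := F)]
  have h := f.finrank_range_add_finrank_ker
  rw [LinearMap.range_eq_top.mpr hf, finrank_top, Module.finrank_self] at h
  rw [← h, Nat.add_sub_cancel_left]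

end Counting

/-! ### Arithmetic of Δ and the gcd conditions. -/

section Arithmetic

theorem cyclicDelta_eq_geom_sum {q : ℕ} (hq : 1 < q) (k : ℕ) :
    cyclicDelta q k = ∑ i ∈ Finset.range k, q ^ i := by
  rw [cyclicDelta, Nat.geomSum_eq hq]

theorem cyclicDelta_mul {q : ℕ} (hq : 1 < q) (k : ℕ) :
    cyclicDelta q k * (q - 1) = q ^ k - 1 := by
  rw [cyclicDelta_eq_geom_sum hq, geom_sum_mul_of_one_le hq.le]

theorem sub_one_dvd_cyclicDelta_sub {q : ℕ} (hq : 1 < q) (k : ℕ) :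
    (q : ℤ) - 1 ∣ (cyclicDelta q k : ℤ) - k := by
  rw [cyclicDelta_eq_geom_sum hq]
  have : (((∑ i ∈ Finset.range k, q ^ i : ℕ) : ℤ) - k) =
      ∑ i ∈ Finset.range k, ((q : ℤ) ^ i - 1) := by
    simp [Finset.sum_sub_distrib]
  rw [this]
  exact Finset.dvd_sum fun i _ => sub_one_dvd_pow_sub_one _ i

/-- Factor q^k - 1 = Δ(q - 1). Modulo Δ the right-hand number is e₂; modulo q - 1, where Δ ≡ k, it
is -(ke₁ - e₂). -/
theorem isCoprime_pow_sub_one_iff {q : ℕ} (hq : 1 < q) (k : ℕ) (e₁ e₂ : ℤ) :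
    IsCoprime ((q ^ k - 1 : ℕ) : ℤ) (e₂ - cyclicDelta q k * e₁) ↔
      Int.gcd ((q : ℤ) - 1) ((k : ℤ) * e₁ - e₂) = 1 ∧ Int.gcd (cyclicDelta q k : ℤ) e₂ = 1 := by
  obtain ⟨t, ht⟩ := sub_one_dvd_cyclicDelta_sub hq k
  rw [← cyclicDelta_mul hq, Nat.cast_mul, Nat.cast_sub hq.le, Nat.cast_one, IsCoprime.mul_left_iff,
    ← Int.isCoprime_iff_gcd_eq_one, ← Int.isCoprime_iff_gcd_eq_one, and_comm]
  refine and_congr ?_ ?_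
  · rw [show e₂ - cyclicDelta q k * e₁ = -((k * e₁ - e₂) + ((q : ℤ) - 1) * (t * e₁)) by
      linear_combination (-e₁) * ht, IsCoprime.neg_right_iff, IsCoprime.add_mul_left_right_iff]
  · rw [sub_eq_add_neg, ← mul_neg, IsCoprime.add_mul_left_right_iff]

end Arithmetic

/-! ### Powers of γ, and the units of F inside K. -/

section Units

variable {G : Type*} [Group G] {γ : G}

theorem orderOf_dvd_of_zpow_pow_eq_one {m : ℤ} (hm : IsCoprime (orderOf γ : ℤ) m) {d : ℕ}
    (hd : (γ ^ m) ^ d = 1) : orderOf γ ∣ d := by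
  rw [← zpow_natCast, ← zpow_mul, ← orderOf_dvd_iff_zpow_eq_one] at hd
  exact_mod_cast hm.dvd_of_dvd_mul_left hd

theorem isCoprime_orderOf_of_forall (h0 : 0 < orderOf γ) {m : ℤ}
    (h : ∀ d : ℕ, (γ ^ m) ^ d = 1 → orderOf γ ∣ d) : IsCoprime (orderOf γ : ℤ) m := by
  obtain ⟨a, ha⟩ : (Int.gcd (orderOf γ) m) ∣ orderOf γ := by
    exact_mod_cast Int.gcd_dvd_left (orderOf γ : ℤ) m
  obtain ⟨b, hb⟩ := Int.gcd_dvd_right (orderOf γ : ℤ) m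
  -- Test with d = a, the order divided by the gcd: the order then divides a, which forces the gcd
  -- to be 1.
  have h1 : orderOf γ ∣ a := by
    apply h
    rw [← zpow_natCast, ← zpow_mul, ← orderOf_dvd_iff_zpow_eq_one]
    refine ⟨b, ?_⟩
    nth_rewrite 1 [hb]
    nth_rewrite 2 [ha]
    push_cast
    ring
  rw [Int.isCoprime_iff_gcd_eq_one]
  have ha0 : 0 < a := Nat.pos_of_ne_zero fun h' => by rw [h', mul_zero] at ha; omega
  have := Nat.le_of_dvd ha0 h1
  have hg : Int.gcd (orderOf γ) m ≠ 0 := fun h' => by rw [h', zero_mul] at ha; omega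
  by_contra hne
  have : 2 * a ≤ Int.gcd (orderOf γ) m * a := Nat.mul_le_mul_right _ (by omega)
  omega

variable {F K : Type*} [Field F] [Finite F] [Field K] [Algebra F K] {q k : ℕ}

/-- The q - 1 units of F already exhaust the solutions of y^(q-1) = 1, of which a field has at most
q - 1. -/
theorem mem_range_of_pow_card_sub_one_eq_one [Finite K] (hq : Nat.card F = q) {x : Kˣ}
    (hx : x ^ (q - 1) = 1) : ∃ l : Fˣ, Units.map (algebraMap F K : F →* K) l = x := by
  classical
  have := Fintype.ofFinite F
  have := Fintype.ofFinite Kˣ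
  have hq1 : 0 < q - 1 := by
    have := Finite.one_lt_card (α := F)
    omega
  have hinj : Function.Injective (Units.map (algebraMap F K : F →* K)) :=
    Units.map_injective (algebraMap F K).injective
  have hsub : Finset.univ.image (Units.map (algebraMap F K : F →* K)) ⊆
      ({y : Kˣ | y ^ (q - 1) = 1} : Finset Kˣ) := by
    intro y hy
    obtain ⟨l, -, rfl⟩ := Finset.mem_image.mp hy
    rw [Finset.mem_filter_univ, ← map_pow]
    have : l ^ (q - 1) = 1 := by
      rw [← hq, ← Nat.card_units]
      exact pow_card_eq_one'
    rw [this, map_one]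
  have heq := Finset.eq_of_subset_of_card_le hsub (by
    rw [Finset.card_image_of_injective _ hinj, Finset.card_univ, ← Nat.card_eq_fintype_card,
      Nat.card_units, hq]
    exact IsCyclic.card_pow_eq_one_le hq1)
  have hx' : x ∈ ({y : Kˣ | y ^ (q - 1) = 1} : Finset Kˣ) := by simpa using hx
  rw [← heq] at hx'
  obtain ⟨l, -, hl⟩ := Finset.mem_image.mp hx'
  exact ⟨l, hl⟩

theorem exists_units_map_eq_zpow_cyclicDelta_mul [Finite K] (hq : Nat.card F = q) {γ : Kˣ}
    (hγ : orderOf γ = q ^ k - 1) (e : ℤ) :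
    ∃ l : Fˣ, Units.map (algebraMap F K : F →* K) l = γ ^ ((cyclicDelta q k : ℤ) * e) := by
  have hq1 : 1 < q := hq ▸ Finite.one_lt_card
  apply mem_range_of_pow_card_sub_one_eq_one hq
  rw [← zpow_natCast, ← zpow_mul, ← orderOf_dvd_iff_zpow_eq_one, hγ, ← cyclicDelta_mul hq1]
  exact ⟨e, by push_cast; ring⟩

theorem exists_zpow_cyclicDelta_mul_eq (hq : Nat.card F = q) {γ : Kˣ}
    (hγ : orderOf γ = q ^ k - 1) (hγ' : ∀ x : Kˣ, x ∈ Subgroup.zpowers γ) (l : Fˣ) :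
    ∃ e : ℤ, Units.map (algebraMap F K : F →* K) l = γ ^ ((cyclicDelta q k : ℤ) * e) := by
  have hq1 : 1 < q := hq ▸ Finite.one_lt_card
  obtain ⟨m, hm⟩ := hγ' (Units.map (algebraMap F K : F →* K) l)
  have hm : γ ^ m = Units.map (algebraMap F K : F →* K) l := hm
  have hl : l ^ (q - 1) = 1 := by
    rw [← hq, ← Nat.card_units]
    exact pow_card_eq_one'
  have h1 : γ ^ (m * ((q - 1 : ℕ) : ℤ)) = 1 := by
    rw [zpow_mul, hm, zpow_natCast, ← map_pow, hl, map_one]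
  rw [← orderOf_dvd_iff_zpow_eq_one, hγ, ← cyclicDelta_mul hq1, Nat.cast_mul] at h1
  obtain ⟨e, he⟩ := Int.dvd_of_mul_dvd_mul_right (by
    have : q - 1 ≠ 0 := by omega
    exact_mod_cast this) h1
  exact ⟨e, by rw [← he, hm]⟩

end Units

end

noncomputable section

/-! ### Trace words, their annihilating polynomial and their weights. -/

section TraceWords

variable {F K : Type*} [Field F] [Field K] [Algebra F K]

/-- The word with entries `a * l ^ i + Tr (b * x ^ i)`. -/
def traceWord (n : ℕ) (l : F) (x : K) : F × K →ₗ[F] (Fin n → F) where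
  toFun p i := p.1 * l ^ (i : ℕ) + Algebra.trace F K (p.2 * x ^ (i : ℕ))
  map_add' p r := by
    ext i
    simp only [Prod.fst_add, Prod.snd_add, add_mul, map_add, Pi.add_apply]
    ring
  map_smul' a p := by
    ext i
    simp only [Prod.smul_fst, Prod.smul_snd, smul_mul_assoc, map_smul, Pi.smul_apply,
      RingHom.id_apply, smul_add]

theorem traceWord_apply (n : ℕ) (l : F) (x : K) (p : F × K) (i : Fin n) :
    traceWord n l x p i = p.1 * l ^ (i : ℕ) + Algebra.trace F K (p.2 * x ^ (i : ℕ)) := rfl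

/-- Shifting right replaces b by b x⁻¹; this is why minimal polynomials of inverses occur. -/
theorem aeval_rightShift_trace {n : ℕ} [NeZero n] {x : K} (hx : x ^ n = 1) (p : F[X]) (b : K) :
    aeval (rightShift F n) p (fun i : Fin n => Algebra.trace F K (b * x ^ (i : ℕ))) =
      fun i : Fin n => Algebra.trace F K (b * aeval x⁻¹ p * x ^ (i : ℕ)) := by
  have hx0 : x ≠ 0 := by
    rintro rfl
    rw [zero_pow (NeZero.ne n)] at hx
    exact zero_ne_one hx
  have hshift : ∀ b : K, rightShift F n (fun i : Fin n => Algebra.trace F K (b * x ^ (i : ℕ))) =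
      fun i : Fin n => Algebra.trace F K (b * x⁻¹ * x ^ (i : ℕ)) := by
    intro b
    ext i
    have h := pow_val_add_one hx (i - 1)
    rw [sub_add_cancel] at h
    rw [rightShift_apply, h]
    congr 1
    field_simp
  induction p using Polynomial.induction_on generalizing b with
  | C a =>
    ext i
    simp only [aeval_C, Module.algebraMap_end_apply, Pi.smul_apply]
    rw [← map_smul, Algebra.smul_def]
    congr 1
    ring
  | add p r hp hr =>
    rw [map_add, LinearMap.add_apply, hp, hr]
    ext i
    rw [Pi.add_apply, ← map_add, map_add (aeval x⁻¹)]
    congr 1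
    ring
  | monomial j a ih =>
    rw [pow_succ, ← mul_assoc, map_mul, aeval_X, Module.End.mul_apply, hshift, ih,
      map_mul (aeval x⁻¹) (C a * X ^ j), aeval_X]
    ext i
    congr 1
    ring

theorem aeval_rightShift_traceWord {n : ℕ} [NeZero n] {l : F} {x : K} (hl : l ^ n = 1)
    (hx : x ^ n = 1) (p : F × K) :
    aeval (rightShift F n) (minpoly F l⁻¹ * minpoly F x⁻¹) (traceWord n l x p) = 0 := by
  have h : traceWord n l x p = (fun i : Fin n => Algebra.trace F F (p.1 * l ^ (i : ℕ))) +
      fun i : Fin n => Algebra.trace F K (p.2 * x ^ (i : ℕ)) := by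
    ext i
    simp [traceWord_apply]
  have h1 : aeval l⁻¹ (minpoly F l⁻¹ * minpoly F x⁻¹) = 0 := by
    rw [map_mul, minpoly.aeval, zero_mul]
  have h2 : aeval x⁻¹ (minpoly F l⁻¹ * minpoly F x⁻¹) = 0 := by
    rw [map_mul, minpoly.aeval, mul_zero]
  rw [h, map_add, aeval_rightShift_trace hl, aeval_rightShift_trace hx, h1, h2]
  ext i
  simp

theorem weight_identity {q k : ℕ} (hk : 0 < k) :
    q ^ (k - 1) * (q - 1) = q ^ k - q ^ (k - 1) := by
  obtain ⟨j, rfl⟩ := Nat.exists_eq_succ_of_ne_zero hk.ne'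
  rw [Nat.mul_sub, mul_one, Nat.succ_eq_add_one, Nat.add_sub_cancel, pow_succ]

theorem ncard_trace_add_ne_zero [Finite F] [Module.Finite F K] {q k : ℕ} (hq : Nat.card F = q)
    (hK : Module.finrank F K = k) [DecidableEq F] (a : F) :
    {x : K | x ≠ 0 ∧ a + Algebra.trace F K x ≠ 0}.ncard =
      if a = 0 then q ^ (k - 1) * (q - 1) else q ^ (k - 1) * (q - 1) - 1 := by
  have : Finite K := Module.finite_of_finite F
  have hk : 0 < k := hK ▸ Module.finrank_pos
  have hfib : {x : K | Algebra.trace F K x = -a}.ncard = q ^ (k - 1) := by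
    rw [← hq, ← hK]
    exact LinearMap.card_fiber_eq_pow (Algebra.trace F K) (Algebra.trace_surjective F K) (-a)
  -- Zero already lies in the removed fibre exactly when a = 0; otherwise one more element is
  -- removed.
  have hcompl : {x : K | x ≠ 0 ∧ a + Algebra.trace F K x ≠ 0} =
      (insert 0 {x : K | Algebra.trace F K x = -a})ᶜ := by
    ext x
    simp [eq_neg_iff_add_eq_zero, add_comm]
  rw [hcompl, Set.ncard_compl, Module.natCard_eq_pow_finrank (K := F), hq, hK, weight_identity hk]
  split_ifs with ha
  · rw [Set.insert_eq_of_mem (by simp [ha]), hfib]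
  · rw [Set.ncard_insert_of_notMem (by simpa [eq_comm] using ha), hfib, Nat.sub_sub]

theorem hammingNorm_traceWord [Finite F] [Module.Finite F K] [DecidableEq F] [DecidableEq K]
    {q k : ℕ} (hq : Nat.card F = q) (hK : Module.finrank F K = k) {θ : Kˣ}
    (hθ : orderOf θ = q ^ k - 1) {l : F} (hl : l ≠ 0) {x : K} (hx : x = algebraMap F K l * θ)
    (p : F × K) :
    hammingNorm (traceWord (q ^ k - 1) l x p) =
      if p.2 = 0 then (if p.1 = 0 then 0 else q ^ k - 1)
      else if p.1 = 0 then q ^ (k - 1) * (q - 1) else q ^ (k - 1) * (q - 1) - 1 := by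
  have : Finite K := Module.finite_of_finite F
  obtain ⟨a, b⟩ := p
  have hval : ∀ i : Fin (q ^ k - 1), traceWord (q ^ k - 1) l x (a, b) i =
      l ^ (i : ℕ) * (a + Algebra.trace F K (b * ((θ ^ (i : ℕ) : Kˣ) : K))) := by
    intro i
    rw [traceWord_apply, mul_add, ← smul_eq_mul (l ^ (i : ℕ)) (Algebra.trace F K _), ← map_smul,
      Algebra.smul_def, hx]
    rw [Units.val_pow_eq_pow_val, map_pow, mul_pow, mul_comm a, mul_left_comm b]
  have hne : ∀ i : Fin (q ^ k - 1), traceWord (q ^ k - 1) l x (a, b) i ≠ 0 ↔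
      a + Algebra.trace F K (b * ((θ ^ (i : ℕ) : Kˣ) : K)) ≠ 0 := by
    intro i
    rw [hval, mul_ne_zero_iff, and_iff_right (pow_ne_zero _ hl)]
  by_cases hb : b = 0
  · subst hb
    by_cases ha : a = 0
    · subst ha
      simp [hammingNorm, hne]
    · simp [hammingNorm, hne, ha]
  · rw [if_neg hb, ← ncard_trace_add_ne_zero hq hK a]
    have hinj : Function.Injective fun i : Fin (q ^ k - 1) => b * ((θ ^ (i : ℕ) : Kˣ) : K) := by
      intro i j hij
      have := Units.ext (mul_left_cancel₀ hb hij)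
      exact Fin.ext (pow_injOn_Iio_orderOf (by simp [hθ]) (by simp [hθ]) this)
    have hsurj : ∀ y : K, y ≠ 0 → ∃ i : Fin (q ^ k - 1), b * ((θ ^ (i : ℕ) : Kˣ) : K) = y := by
      intro y hy
      have hbij : Function.Bijective fun i : Fin (q ^ k - 1) => (θ ^ (i : ℕ) : Kˣ) := by
        rw [Nat.bijective_iff_injective_and_card]
        refine ⟨fun i j hij => hinj (congrArg (fun u : Kˣ => b * (u : K)) hij), ?_⟩
        rw [Nat.card_units, Nat.card_fin, Module.natCard_eq_pow_finrank (K := F), hq, hK]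
      obtain ⟨i, hi⟩ := hbij.2 (Units.mk0 (b⁻¹ * y) (mul_ne_zero (inv_ne_zero hb) hy))
      refine ⟨i, ?_⟩
      simp only [] at hi
      rw [hi, Units.val_mk0, mul_inv_cancel_left₀ hb]
    rw [hammingNorm, ← Set.ncard_coe_finset, ← Set.ncard_image_of_injective _ hinj]
    congr 1
    ext y
    simp only [Finset.coe_filter, Finset.mem_univ, true_and, Set.mem_image, Set.mem_ofPred_eq, hne]
    constructor
    · rintro ⟨i, hi, rfl⟩
      exact ⟨mul_ne_zero hb (Units.ne_zero _), hi⟩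
    · rintro ⟨hy, hay⟩
      obtain ⟨i, rfl⟩ := hsurj y hy
      exact ⟨i, hay, rfl⟩

/-- Makes the four weights distinct; for k = 1 the two largest would coincide. -/
theorem weights_lt {q k : ℕ} (hq : 1 < q) (hk : 1 < k) :
    1 < q ^ (k - 1) * (q - 1) ∧ q ^ (k - 1) * (q - 1) < q ^ k - 1 := by
  have h1 : q ^ 1 ≤ q ^ (k - 1) := Nat.pow_le_pow_right (by omega) (by omega)
  rw [pow_one] at h1
  have h2 : q ^ (k - 1) * 1 ≤ q ^ (k - 1) * (q - 1) := Nat.mul_le_mul_left _ (by omega)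
  have h3 : q ^ (k - 1) ≤ q ^ k := Nat.pow_le_pow_right (by omega) (by omega)
  have h4 := weight_identity (q := q) (k := k) (by omega)
  omega

theorem hasThreeWeightDistribution_of_eq_range_traceWord [Finite F] [Module.Finite F K]
    [DecidableEq F] {q k : ℕ} (hq : Nat.card F = q) (hk : 1 < k) (hK : Module.finrank F K = k)
    {θ : Kˣ} (hθ : orderOf θ = q ^ k - 1) {l : F} (hl : l ≠ 0) {x : K}
    (hx : x = algebraMap F K l * θ) {code : Submodule F (Fin (q ^ k - 1) → F)}
    (hcard : Module.finrank F code = k + 1) (hcode : ∀ p, traceWord (q ^ k - 1) l x p ∈ code) :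
    HasThreeWeightDistribution q k code := by
  classical
  have : Finite K := Module.finite_of_finite F
  have hq1 : 1 < q := hq ▸ Finite.one_lt_card
  obtain ⟨hw1, hw2⟩ := weights_lt hq1 hk
  have hwt := hammingNorm_traceWord hq hK hθ hl hx
  -- A pair in the kernel gives a word of weight 0, and the weight formula allows this only for the
  -- zero pair.
  have hinj : Function.Injective (traceWord (q ^ k - 1) l x) := by
    rw [← LinearMap.ker_eq_bot, LinearMap.ker_eq_bot']
    rintro ⟨a, b⟩ hp
    have h0 := hwt (a, b)
    rw [hp, hammingNorm_zero] at h0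
    split_ifs at h0 with h1 h2 h2
    · exact Prod.ext h2 h1
    all_goals omega
  have hrange : code = LinearMap.range (traceWord (q ^ k - 1) l x) := by
    refine (Submodule.eq_of_le_of_finrank_eq ?_ ?_).symm
    · rintro _ ⟨p, rfl⟩
      exact hcode p
    · rw [LinearMap.finrank_range_of_inj hinj, hcard, Module.finrank_prod, hK,
        Module.finrank_self, add_comm]
  have hfreq : ∀ w, weightFrequency code w =
      {p : F × K | hammingNorm (traceWord (q ^ k - 1) l x p) = w}.ncard := by
    intro w
    rw [weightFrequency, ← Set.ncard_image_of_injective _ hinj]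
    congr 1
    ext c
    simp only [hrange, LinearMap.mem_range, Set.mem_ofPred_eq, Set.mem_image]
    constructor
    · rintro ⟨⟨p, rfl⟩, hp⟩
      exact ⟨p, hp, rfl⟩
    · rintro ⟨p, hp, rfl⟩
      exact ⟨⟨p, rfl⟩, hp⟩
  have hcF : ({0}ᶜ : Set F).ncard = q - 1 := by
    rw [Set.ncard_compl, hq, Set.ncard_singleton]
  have hcK : ({0}ᶜ : Set K).ncard = q ^ k - 1 := by
    rw [Set.ncard_compl, Module.natCard_eq_pow_finrank (K := F), hq, hK, Set.ncard_singleton]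
  refine ⟨?_, ?_, ?_, ?_, ?_⟩
  · rw [hfreq, show {p : F × K | hammingNorm (traceWord (q ^ k - 1) l x p) = 0} =
      {0} ×ˢ {0} by
        ext ⟨a, b⟩
        simp only [hwt, Set.mem_ofPred_eq, Set.mem_prod, Set.mem_singleton_iff]
        split_ifs <;> simp_all <;> omega, Set.ncard_prod]
    simp
  · rw [hfreq, show {p : F × K | hammingNorm (traceWord (q ^ k - 1) l x p) =
        q ^ (k - 1) * (q - 1) - 1} = {0}ᶜ ×ˢ {0}ᶜ by
        ext ⟨a, b⟩
        simp only [hwt, Set.mem_ofPred_eq, Set.mem_prod, Set.mem_compl_iff, Set.mem_singleton_iff]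
        split_ifs <;> simp [*] <;> omega, Set.ncard_prod, hcF, hcK]
  · rw [hfreq, show {p : F × K | hammingNorm (traceWord (q ^ k - 1) l x p) =
        q ^ (k - 1) * (q - 1)} = {0} ×ˢ {0}ᶜ by
        ext ⟨a, b⟩
        simp only [hwt, Set.mem_ofPred_eq, Set.mem_prod, Set.mem_compl_iff, Set.mem_singleton_iff]
        split_ifs <;> simp [*] <;> omega, Set.ncard_prod, hcK]
    simp
  · rw [hfreq, show {p : F × K | hammingNorm (traceWord (q ^ k - 1) l x p) =
        q ^ k - 1} = {0}ᶜ ×ˢ {0} by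
        ext ⟨a, b⟩
        simp only [hwt, Set.mem_ofPred_eq, Set.mem_prod, Set.mem_compl_iff, Set.mem_singleton_iff]
        split_ifs <;> simp only [*, and_true, not_true, not_false_eq_true, and_false,
          iff_false] <;> omega, Set.ncard_prod, hcF]
    simp
  · intro w h0 h1 h2 h3
    rw [hfreq, show {p : F × K | hammingNorm (traceWord (q ^ k - 1) l x p) = w} = ∅ by
      ext ⟨a, b⟩
      simp only [hwt, Set.mem_ofPred_eq, Set.mem_empty_iff_false, iff_false]
      split_ifs <;> exact Ne.symm ‹_›, Set.ncard_empty]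

end TraceWords

end

noncomputable section

/-! ### Consequences of the weight distribution. -/

section Distribution

variable {F : Type*} [Field F] [DecidableEq F]

theorem exists_mem_of_weightFrequency_ne_zero {n : ℕ} {code : Submodule F (Fin n → F)} {w : ℕ}
    (h : weightFrequency code w ≠ 0) : ∃ c ∈ code, hammingNorm c = w := by
  obtain ⟨c, hc⟩ := Set.nonempty_of_ncard_ne_zero h
  exact ⟨c, hc⟩

theorem addOrderOf_dvd_hammingNorm {n : ℕ} [NeZero n] (c : Fin n → F) (s : Fin n)
    (h : ∀ i, c i ≠ 0 → c (i + s) ≠ 0) : addOrderOf s ∣ hammingNorm c := by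
  convert addOrderOf_dvd_card_of_forall_add_mem s {i | c i ≠ 0} h using 1
  rw [hammingNorm, Nat.card_coe_set_eq, ← Set.ncard_coe_finset]
  congr 1
  ext
  simp

variable [Finite F] {q k : ℕ} {code : Submodule F (Fin (q ^ k - 1) → F)}

theorem HasThreeWeightDistribution.finrank_eq (hq : Nat.card F = q) (hk : 1 < k)
    (h : HasThreeWeightDistribution q k code) : Module.finrank F code = k + 1 := by
  classical
  have := Fintype.ofFinite F
  have hq1 : 1 < q := hq ▸ Finite.one_lt_card
  obtain ⟨hw1, hw2⟩ := weights_lt hq1 hk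
  obtain ⟨h0, h1, h2, h3, h4⟩ := h
  have hfreq : ∀ w, weightFrequency code w =
      (({c | c ∈ code} : Finset (Fin (q ^ k - 1) → F)).filter fun c => hammingNorm c = w).card := by
    intro w
    rw [weightFrequency, ← Set.ncard_coe_finset]
    congr 1
    ext c
    simp
  have hcard := Finset.card_eq_sum_card_fiberwise
    (s := ({c | c ∈ code} : Finset (Fin (q ^ k - 1) → F))) (f := hammingNorm)
    (t := {0, q ^ (k - 1) * (q - 1) - 1, q ^ (k - 1) * (q - 1), q ^ k - 1}) (by
      intro c hc
      by_contra hne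
      simp only [Finset.coe_insert, Finset.coe_singleton, Set.mem_insert_iff,
        Set.mem_singleton_iff, not_or] at hne
      have hz := h4 _ hne.1 hne.2.1 hne.2.2.1 hne.2.2.2
      rw [hfreq, Finset.card_eq_zero] at hz
      exact Finset.notMem_empty c (hz ▸ Finset.mem_filter.mpr ⟨hc, rfl⟩))
  simp only [← hfreq] at hcard
  rw [Finset.sum_insert (by simp; omega), Finset.sum_insert (by simp; omega),
    Finset.sum_insert (by simp; omega), Finset.sum_singleton, h0, h1, h2, h3] at hcard
  have hc : Nat.card code = q ^ (k + 1) := by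
    rw [Nat.card_eq_fintype_card, Fintype.card_subtype, hcard]
    -- With a = q - 1 and b = q^k - 1 the total is 1 + ab + b + a = (a + 1)(b + 1).
    obtain ⟨a, rfl⟩ : ∃ a, q = a + 1 := ⟨q - 1, by omega⟩
    obtain ⟨b, hb⟩ : ∃ b, (a + 1) ^ k = b + 1 := ⟨(a + 1) ^ k - 1, by omega⟩
    rw [pow_succ, hb]
    simp only [Nat.add_sub_cancel]
    ring
  rw [Module.natCard_eq_pow_finrank (K := F), hq] at hc
  exact Nat.pow_right_injective hq1 hc

theorem HasThreeWeightDistribution.exists_eigenword [NeZero (q ^ k - 1)] (hq : Nat.card F = q)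
    (hcode : IsCyclicCode code) (h : HasThreeWeightDistribution q k code) :
    ∃ u ∈ code, (∀ i, u i ≠ 0) ∧ ∃ l : F, l ≠ 0 ∧ ∀ i, u (i + 1) = l * u i := by
  have hq1 : 1 < q := hq ▸ Finite.one_lt_card
  have hnz : ∀ c : Fin (q ^ k - 1) → F, hammingNorm c = q ^ k - 1 ↔ ∀ i, c i ≠ 0 := by
    intro c
    rw [hammingNorm]
    conv_lhs => rhs; rw [← Fintype.card_fin (q ^ k - 1)]
    rw [Finset.card_eq_iff_eq_univ, Finset.filter_eq_self]
    simp
  have h3 := h.2.2.2.1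
  obtain ⟨u, hu, hun⟩ := exists_mem_of_weightFrequency_ne_zero (code := code)
    (w := q ^ k - 1) (by omega)
  have hu0 := (hnz u).mp hun
  have hinj : Function.Injective fun a : F => a • u := by
    intro a b hab
    have := congrFun hab 0
    exact mul_right_cancel₀ (hu0 0) this
  -- The q - 1 nonzero multiples of u account for all words of full weight; the shift of u is one of
  -- them.
  have hmul : (fun a : F => a • u) '' {0}ᶜ = {c | c ∈ code ∧ hammingNorm c = q ^ k - 1} := by
    refine Set.eq_of_subset_of_ncard_le ?_ ?_ (Set.toFinite _)
    · rintro _ ⟨a, ha, rfl⟩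
      exact ⟨code.smul_mem a hu, (hnz _).mpr fun i => mul_ne_zero ha (hu0 i)⟩
    · rw [Set.ncard_image_of_injective _ hinj, Set.ncard_compl, Set.ncard_singleton, hq]
      exact h3.le
  have hrot : u ∘ finRotate _ ∈ {c | c ∈ code ∧ hammingNorm c = q ^ k - 1} :=
    ⟨hcode u hu, (hnz _).mpr fun i => hu0 _⟩
  rw [← hmul] at hrot
  obtain ⟨l, hl, hlu⟩ := hrot
  refine ⟨u, hu, hu0, l, hl, fun i => ?_⟩
  have := congrFun hlu i
  simp only [Pi.smul_apply, smul_eq_mul, Function.comp_apply, finRotate_apply] at this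
  exact this.symm

/-- The order of s divides the two middle weights, which differ by 1. -/
theorem HasThreeWeightDistribution.eq_zero_of_periodic [NeZero (q ^ k - 1)]
    (hq : Nat.card F = q) (hk : 1 < k) (h : HasThreeWeightDistribution q k code)
    {s : Fin (q ^ k - 1)} (hs : ∀ c ∈ code, ∀ i, c i ≠ 0 → c (i + s) ≠ 0) : s = 0 := by
  have hq1 : 1 < q := hq ▸ Finite.one_lt_card
  obtain ⟨hw1, hw2⟩ := weights_lt hq1 hk
  obtain ⟨_, h1, h2, _⟩ := h
  have hn : 0 < q ^ k - 1 := NeZero.pos _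
  obtain ⟨c, hc, hcw⟩ := exists_mem_of_weightFrequency_ne_zero
    (by rw [h1]; exact (Nat.mul_pos (by omega) hn).ne')
  obtain ⟨d, hd, hdw⟩ := exists_mem_of_weightFrequency_ne_zero (by rw [h2]; exact hn.ne')
  have hc' := addOrderOf_dvd_hammingNorm c s (hs c hc)
  have hd' := addOrderOf_dvd_hammingNorm d s (hs d hd)
  rw [hcw] at hc'
  rw [hdw] at hd'
  have := Nat.dvd_sub hd' hc'
  rw [Nat.sub_sub_self hw1.le, Nat.dvd_one, AddMonoid.addOrderOf_eq_one_iff] at this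
  exact this

/-- Cyclicity carries the coincidence at i and j to every translate of the pair, so j - i preserves
all supports. -/
theorem HasThreeWeightDistribution.eq_of_div_eq [NeZero (q ^ k - 1)]
    (hq : Nat.card F = q) (hk : 1 < k) (hcode : IsCyclicCode code)
    (h : HasThreeWeightDistribution q k code) {u : Fin (q ^ k - 1) → F} (hu : ∀ i, u i ≠ 0)
    {l : F} (hul : ∀ i, u (i + 1) = l * u i) {i j : Fin (q ^ k - 1)}
    (hij : ∀ c ∈ code, c i / u i = c j / u j) : i = j := by
  have hstep : ∀ (t : ℕ), ∀ c ∈ code, c (i + Fin.ofNat _ t) / u (i + Fin.ofNat _ t) =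
      c (j + Fin.ofNat _ t) / u (j + Fin.ofNat _ t) := by
    intro t
    induction t with
    | zero => simpa using hij
    | succ t ih =>
      intro c hc
      have ht : Fin.ofNat (q ^ k - 1) (t + 1) = Fin.ofNat (q ^ k - 1) t + 1 := by
        ext; simp [Fin.val_add]
      have := ih _ (hcode c hc)
      simp only [Function.comp_apply, finRotate_apply] at this
      rw [ht, ← add_assoc, ← add_assoc, hul, hul, mul_comm l, mul_comm l, ← div_div, ← div_div,
        this]
  rw [eq_comm, ← sub_eq_zero]
  refine h.eq_zero_of_periodic hq hk fun c hc m hm => ?_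
  have := hstep (m - i : Fin (q ^ k - 1)) c hc
  rw [Fin.ofNat_val_eq_self, add_sub_cancel, show j + (m - i) = m + (j - i) by abel] at this
  intro h0
  rw [h0, zero_div, div_eq_zero_iff] at this
  exact this.elim hm (hu m)

end Distribution

end

noncomputable section

/-! ### Invariant subspaces and the missing functional. -/

section Structure

theorem aeval_apply_mem {F V : Type*} [Field F] [AddCommGroup V] [Module F V]
    {f : Module.End F V} {W : Submodule F V} (hW : ∀ v ∈ W, f v ∈ W) (p : F[X]) {v : V}
    (hv : v ∈ W) : aeval f p v ∈ W := by
  induction p using Polynomial.induction_on generalizing v with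
  | C a => simpa using W.smul_mem a hv
  | add p r hp hr =>
    rw [map_add]
    exact W.add_mem (hp hv) (hr hv)
  | monomial j a ih =>
    rw [pow_succ, ← mul_assoc, map_mul, aeval_X, Module.End.mul_apply]
    exact ih (hW v hv)

/-- A nonzero subspace without proper nonzero invariant subspaces is annihilated by an irreducible
factor of any nonzero polynomial that annihilates it. -/
theorem exists_irreducible_dvd_of_aeval_eq_zero {F V : Type*} [Field F] [AddCommGroup V]
    [Module F V] {f : Module.End F V} {W : Submodule F V} (hW : ∀ v ∈ W, f v ∈ W) (hW0 : W ≠ ⊥)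
    (hirr : ∀ U ≤ W, (∀ v ∈ U, f v ∈ U) → U = ⊥ ∨ U = W) (p : F[X]) (hp0 : p ≠ 0)
    (hp : ∀ v ∈ W, aeval f p v = 0) :
    ∃ r, Irreducible r ∧ r ∣ p ∧ ∀ v ∈ W, aeval f r v = 0 := by
  induction p using WfDvdMonoid.induction_on_irreducible with
  | zero => exact absurd rfl hp0
  | unit p hu =>
    refine absurd ((Submodule.eq_bot_iff _).mpr fun v hv => ?_) hW0
    obtain ⟨r, hr⟩ := hu.exists_left_inv
    have := congrArg (fun g : F[X] => aeval f g v) hr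
    simpa [hp v hv] using this.symm
  | mul a i ha hi ih =>
    -- Either the factor i acts injectively on W, so the cofactor a already kills W, or i itself
    -- kills W.
    rcases hirr (W ⊓ LinearMap.ker (aeval f i)) inf_le_left (fun v hv => ⟨hW v hv.1, by
        have hv2 : aeval f i v = 0 := hv.2
        have hcomm : aeval f i (f v) = f (aeval f i v) := by
          have := congrArg (fun g : F[X] => aeval f g v) (mul_comm i X)
          simpa using this
        change aeval f i (f v) = 0
        rw [hcomm, hv2, map_zero]⟩) with h | h
    · obtain ⟨r, hr, hra, hrW⟩ := ih ha fun v hv => by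
        have h2 := hp v hv
        rw [map_mul, Module.End.mul_apply] at h2
        have : aeval f a v ∈ W ⊓ LinearMap.ker (aeval f i) := ⟨aeval_apply_mem hW a hv, h2⟩
        rwa [h, Submodule.mem_bot] at this
      exact ⟨r, hr, hra.mul_left i, hrW⟩
    · refine ⟨i, hi, dvd_mul_right i a, fun v hv => ?_⟩
      rw [← h] at hv
      exact hv.2

variable {F : Type*} [Field F] [Finite F]

/-- If the normalised coordinate functionals of a code are all but one of the functionals taking
the value `1` at the eigenword `u`, then the code is the sum of the line of `u` and an irreducible
shift-invariant subspace. -/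
theorem exists_irreducible_complement {n q k : ℕ} [NeZero n] (hq : Nat.card F = q)
    (hn : n = q ^ k - 1) {code : Submodule F (Fin n → F)}
    (hS : ∀ c ∈ code, rightShift F n c ∈ code) (hdim : Module.finrank F code = k + 1)
    {u : Fin n → F} (huc : u ∈ code) (hu : ∀ i, u i ≠ 0) {l : F} (hl : l ≠ 0)
    (hul : ∀ i, u (i + 1) = l * u i)
    (hinj : ∀ i j, (∀ c ∈ code, c i / u i = c j / u j) → i = j) :
    ∃ W : Submodule F (Fin n → F), W ≤ code ∧ (∀ c ∈ W, rightShift F n c ∈ W) ∧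
      Module.finrank F W = k ∧ (∀ c ∈ code, ∃ a : F, c - a • u ∈ W) ∧
      ∀ U ≤ W, (∀ c ∈ U, rightShift F n c ∈ U) → U = ⊥ ∨ U = W := by
  have hq1 : 1 < q := hq ▸ Finite.one_lt_card
  let u' : code := ⟨u, huc⟩
  let S : Module.End F code := (rightShift F n).restrict hS
  have hSval : ∀ (c : code) (i : Fin n), (S c).1 i = c.1 (i - 1) := fun c i => rfl
  have hSu : S u' = l⁻¹ • u' := by
    refine Subtype.ext (funext fun i => ?_)
    have := hul (i - 1)
    rw [sub_add_cancel] at this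
    rw [hSval]
    simp only [u', Submodule.coe_smul, Pi.smul_apply, smul_eq_mul]
    rw [this, inv_mul_cancel_left₀ hl]
  have hSsurj : Function.Surjective S := by
    rw [← LinearMap.injective_iff_surjective]
    intro c d hcd
    refine Subtype.ext (funext fun i => ?_)
    have := congrFun (congrArg Subtype.val hcd) (i + 1)
    simpa [hSval] using this
  let A : Set (Module.Dual F code) := {φ | φ u' = 1}
  have hA : A.ncard = q ^ k := by
    have h := LinearMap.card_fiber_eq_pow (Module.Dual.eval F code u') (fun t => by
      obtain ⟨f, hf⟩ := Module.Projective.exists_dual_ne_zero F (x := u') (fun h0 => hu 0 (by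
        simpa [u'] using congrFun (congrArg Subtype.val h0) 0))
      exact ⟨(t / f u') • f, by simp [hf]⟩) 1
    rw [Subspace.dual_finrank_eq, hdim, hq, Nat.add_sub_cancel] at h
    exact h
  let ψ : Fin n → Module.Dual F code := fun i => (u i)⁻¹ • (LinearMap.proj i ∘ₗ code.subtype)
  have hψ : ∀ i (c : code), ψ i c = (u i)⁻¹ * c.1 i := fun i c => rfl
  have hψA : Set.range ψ ⊆ A := by
    rintro _ ⟨i, rfl⟩
    exact inv_mul_cancel₀ (hu i)
  have hψinj : Function.Injective ψ := by
    intro i j hij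
    refine hinj i j fun c hc => ?_
    have := LinearMap.congr_fun hij ⟨c, hc⟩
    rwa [hψ, hψ, inv_mul_eq_div, inv_mul_eq_div] at this
  have : Finite (Module.Dual F code) := Module.finite_of_finite F
  obtain ⟨φ, hφ⟩ : ∃ φ, A \ Set.range ψ = {φ} := by
    rw [← Set.ncard_eq_one, Set.ncard_sdiff hψA, hA, ← Set.image_univ,
      Set.ncard_image_of_injective _ hψinj, Set.ncard_univ, Nat.card_fin, hn]
    have : 0 < q ^ k := pow_pos (by omega) k
    omega
  have hφA : φ u' = 1 := (hφ ▸ Set.mem_singleton φ : φ ∈ A \ Set.range ψ).1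
  have hφψ : φ ∉ Set.range ψ := (hφ ▸ Set.mem_singleton φ : φ ∈ A \ Set.range ψ).2
  have huniq : ∀ χ : Module.Dual F code, χ u' = 1 → χ ≠ φ → χ ∈ Set.range ψ := by
    intro χ h1 h2
    by_contra h3
    have : χ ∈ A \ Set.range ψ := ⟨h1, h3⟩
    rw [hφ] at this
    exact h2 this
  have hφS : ∀ c, φ (S c) = l⁻¹ * φ c := by
    -- This functional also has value 1 at u. Were it ψ_j, then φ would be ψ_(j+1).
    have : l • (φ ∘ₗ S) = φ := by
      by_contra hne
      obtain ⟨j, hj⟩ := huniq (l • (φ ∘ₗ S)) (by simp [hSu, hφA, hl]) hne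
      refine hφψ ⟨j + 1, LinearMap.ext fun d => ?_⟩
      obtain ⟨c, rfl⟩ := hSsurj d
      have h1 := LinearMap.congr_fun hj c
      simp only [LinearMap.smul_apply, LinearMap.comp_apply, smul_eq_mul] at h1
      rw [hψ] at h1
      rw [hψ, hSval, hul, add_sub_cancel_right, mul_inv, mul_assoc, h1, inv_mul_cancel_left₀ hl]
    intro c
    conv_rhs => rw [← this]
    simp [hl]
  refine ⟨(LinearMap.ker φ).map code.subtype, Submodule.map_subtype_le _ _, ?_, ?_, ?_, ?_⟩
  · rintro _ ⟨c, hc, rfl⟩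
    refine ⟨S c, ?_, rfl⟩
    have hc' : φ c = 0 := hc
    change φ (S c) = 0
    rw [hφS, hc', mul_zero]
  · rw [Submodule.finrank_map_subtype_eq]
    have h := φ.finrank_range_add_finrank_ker
    rw [LinearMap.range_eq_top.mpr (LinearMap.surjective fun h0 => by simp [h0] at hφA),
      finrank_top, Module.finrank_self, hdim] at h
    omega
  · intro c hc
    refine ⟨φ ⟨c, hc⟩, ⟨c, hc⟩ - φ ⟨c, hc⟩ • u', ?_, rfl⟩
    change φ _ = 0
    rw [map_sub, map_smul, hφA, smul_eq_mul, mul_one, sub_self]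
  · intro U hU hUS
    by_contra! hne
    obtain ⟨c, hcW, hcU⟩ := SetLike.exists_of_lt (lt_of_le_of_ne hU hne.2)
    have hker : ∀ d : code, d.1 ∈ (LinearMap.ker φ).map code.subtype → φ d = 0 := by
      rintro d ⟨d', hd', hdd⟩
      obtain rfl : d' = d := Subtype.ext hdd
      exact hd'
    have hcs : c ∉ U ⊔ F ∙ u := by
      intro hmem
      obtain ⟨w, hw, v, hv, rfl⟩ := Submodule.mem_sup.mp hmem
      obtain ⟨a, rfl⟩ := Submodule.mem_span_singleton.mp hv
      have hwW := hU hw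
      have hau : a • u ∈ (LinearMap.ker φ).map code.subtype := by
        simpa using Submodule.sub_mem _ hcW hwW
      have h0 := hker (a • u') hau
      rw [map_smul, hφA, smul_eq_mul, mul_one] at h0
      exact hcU (by simpa [h0] using hw)
    obtain ⟨χ, hχc, hχ⟩ := Submodule.exists_le_ker_of_notMem hcs
    have hχu : χ u = 0 := hχ (Submodule.mem_sup_right (Submodule.mem_span_singleton_self u))
    have hχU : ∀ w ∈ U, χ w = 0 := fun w hw => hχ (Submodule.mem_sup_left hw)
    have hUc : ∀ w ∈ U, w ∈ code := fun w hw => Submodule.map_subtype_le _ _ (hU hw)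
    -- As χ kills u but not c, this is a functional with value 1 at u other than φ, hence a
    -- normalised coordinate; it vanishes on U.
    obtain ⟨i, hi⟩ := huniq (φ + χ ∘ₗ code.subtype) (by simp [hφA, u', hχu]) (by
      intro h0
      have := LinearMap.congr_fun h0 ⟨c, Submodule.map_subtype_le _ _ hcW⟩
      simp [hχc] at this)
    have hUi : ∀ w ∈ U, w i = 0 := by
      intro w hw
      have := LinearMap.congr_fun hi ⟨w, hUc w hw⟩
      rw [hψ, LinearMap.add_apply, hker _ (hU hw)] at this
      simpa [hχU w hw, hu i] using this
    refine hne.1 ((Submodule.eq_bot_iff _).mpr fun w hw => funext fun j => ?_)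
    -- Shifting by i - j moves coordinate j to position i, where all words of U vanish.
    have hpow : aeval (rightShift F n) (X ^ ((i - j : Fin n) : ℕ) : F[X]) w ∈ U :=
      aeval_apply_mem hUS _ hw
    have := hUi _ hpow
    rw [aeval_X_pow, rightShift_pow_apply, Fin.ofNat_val_eq_self, sub_sub_cancel] at this
    exact this

end Structure

end

/-! ### The two implications. -/

section Main

variable {F K : Type*} [Field F] [Field K] [Algebra F K]

theorem hPoly_eq_minpoly_inv {γ : Kˣ} (e : ℤ) : hPoly F γ e = minpoly F ((γ ^ e : Kˣ) : K)⁻¹ := by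
  rw [hPoly, zpow_neg, Units.val_inv_eq_inv_val]

theorem hPoly_eq_minpoly_of_units_map_eq {γ : Kˣ} {l : Fˣ} {e : ℤ}
    (hl : Units.map (algebraMap F K : F →* K) l = γ ^ e) :
    hPoly F γ e = minpoly F (l : F)⁻¹ := by
  rw [hPoly_eq_minpoly_inv, ← hl, Units.coe_map, MonoidHom.coe_coe, ← map_inv₀,
    minpoly.algebraMap_eq (algebraMap F K).injective]

variable [Finite F] [DecidableEq F] [Module.Finite F K] {q k : ℕ}

theorem hasThreeWeightDistribution_of_isParityCheckPolynomial (hq : Nat.card F = q) (hk : 1 < k)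
    (hK : Module.finrank F K = k) {γ : Kˣ} (hγ : orderOf γ = q ^ k - 1)
    {code : Submodule F (Fin (q ^ k - 1) → F)} (hdim : Module.finrank F code = k + 1) {e₁ e₂ : ℤ}
    (hpar : IsParityCheckPolynomial code
      (hPoly F γ ((cyclicDelta q k : ℤ) * e₁) * hPoly F γ e₂))
    (hcop : IsCoprime ((q ^ k - 1 : ℕ) : ℤ) (e₂ - cyclicDelta q k * e₁)) :
    HasThreeWeightDistribution q k code := by
  have : Finite K := Module.finite_of_finite F
  have hq1 : 1 < q := hq ▸ Finite.one_lt_card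
  have : NeZero (q ^ k - 1) := ⟨by have := weights_lt hq1 hk; omega⟩
  have hpow : ∀ x : Kˣ, x ^ (q ^ k - 1) = 1 := by
    intro x
    rw [← hK, ← hq, ← Module.natCard_eq_pow_finrank, ← Nat.card_units]
    exact pow_card_eq_one'
  obtain ⟨l, hl⟩ := exists_units_map_eq_zpow_cyclicDelta_mul hq hγ e₁
  have hθ : orderOf (γ ^ (e₂ - cyclicDelta q k * e₁)) = q ^ k - 1 := by
    refine Nat.dvd_antisymm (orderOf_dvd_of_pow_eq_one (hpow _)) ?_
    nth_rewrite 1 [← hγ]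
    exact orderOf_dvd_of_zpow_pow_eq_one (by rwa [hγ]) (pow_orderOf_eq_one _)
  have hln : (l : F) ^ (q ^ k - 1) = 1 := by
    have h := hpow (Units.map (algebraMap F K : F →* K) l)
    rw [← map_pow] at h
    have := Units.map_injective (f := (algebraMap F K : F →* K)) (algebraMap F K).injective
      (h.trans (map_one _).symm)
    rw [← Units.val_pow_eq_pow_val, this, Units.val_one]
  have hxn : ((γ ^ e₂ : Kˣ) : K) ^ (q ^ k - 1) = 1 := by
    rw [← Units.val_pow_eq_pow_val, hpow, Units.val_one]
  refine hasThreeWeightDistribution_of_eq_range_traceWord hq hk hK hθ l.ne_zero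
    (x := ((γ ^ e₂ : Kˣ) : K)) ?_ hdim fun p => ?_
  · have : γ ^ e₂ = Units.map (algebraMap F K : F →* K) l * γ ^ (e₂ - cyclicDelta q k * e₁) := by
      rw [hl, ← zpow_add, add_sub_cancel]
    exact congrArg Units.val this
  · rw [hpar.mem_iff, hPoly_eq_minpoly_of_units_map_eq hl, hPoly_eq_minpoly_inv]
    exact aeval_rightShift_traceWord hln hxn p

theorem exists_isParityCheckPolynomial_of_hasThreeWeightDistribution (hq : Nat.card F = q)
    (hk : 1 < k) (hK : Module.finrank F K = k) {γ : Kˣ} (hγ : orderOf γ = q ^ k - 1)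
    (hγ' : ∀ x : Kˣ, x ∈ Subgroup.zpowers γ) {code : Submodule F (Fin (q ^ k - 1) → F)}
    (hcode : IsCyclicCode code) (h : HasThreeWeightDistribution q k code) :
    ∃ e₁ e₂ : ℤ, IsParityCheckPolynomial code
        (hPoly F γ ((cyclicDelta q k : ℤ) * e₁) * hPoly F γ e₂) ∧
      IsCoprime ((q ^ k - 1 : ℕ) : ℤ) (e₂ - cyclicDelta q k * e₁) := by
  have : Finite K := Module.finite_of_finite F
  have hq1 : 1 < q := hq ▸ Finite.one_lt_card
  have hn0 : q ^ k - 1 ≠ 0 := by have := weights_lt hq1 hk; omega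
  have : NeZero (q ^ k - 1) := ⟨hn0⟩
  have hpow : ∀ x : K, x ≠ 0 → x ^ (q ^ k - 1) = 1 := by
    intro x hx
    have h : (Units.mk0 x hx) ^ (q ^ k - 1) = 1 := by
      rw [← hK, ← hq, ← Module.natCard_eq_pow_finrank, ← Nat.card_units]
      exact pow_card_eq_one'
    simpa using congrArg Units.val h
  have hdim := h.finrank_eq hq hk
  obtain ⟨u, huc, hu, l, hl, hul⟩ := h.exists_eigenword hq hcode
  have hinj : ∀ i j, (∀ c ∈ code, c i / u i = c j / u j) → i = j :=
    fun i j => h.eq_of_div_eq hq hk hcode hu hul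
  obtain ⟨W, hWc, hWS, hWk, hWu, hWirr⟩ := exists_irreducible_complement hq rfl
    (fun c hc => hcode.rightShift_mem hc) hdim huc hu hl hul hinj
  have hX0 : (X ^ (q ^ k - 1) - 1 : F[X]) ≠ 0 := by
    rw [← C_1]; exact (monic_X_pow_sub_C (1 : F) hn0).ne_zero
  obtain ⟨r, hr, hrX, hrW⟩ := exists_irreducible_dvd_of_aeval_eq_zero hWS (by
    rintro rfl
    rw [finrank_bot] at hWk
    omega) hWirr _ hX0 (fun v _ => by rw [aeval_rightShift_X_pow_sub_one, LinearMap.zero_apply])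
  have hprim : IsPrimitiveRoot (γ : K) (q ^ k - 1) := by
    rw [IsPrimitiveRoot.coe_units_iff, ← hγ]
    exact IsPrimitiveRoot.orderOf γ
  have hmap : r.map (algebraMap F K) ∣ X ^ (q ^ k - 1) - C 1 := by
    simpa using Polynomial.map_dvd (algebraMap F K) hrX
  obtain ⟨x, hx⟩ := ((X_pow_sub_one_splits hprim).of_dvd
    (monic_X_pow_sub_C (1 : K) hn0).ne_zero hmap).exists_eval_eq_zero (by
      rw [degree_map]; exact hr.degree_pos.ne')
  rw [eval_map_algebraMap] at hx
  have hx0 : x ≠ 0 := by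
    rintro rfl
    obtain ⟨s, hs⟩ := hrX
    have := congrArg (aeval (0 : K)) hs
    rw [map_mul, hx, zero_mul] at this
    simp [zero_pow hn0] at this
  obtain ⟨m, hm⟩ := hγ' (Units.mk0 x hx0)⁻¹
  have hm : γ ^ m = (Units.mk0 x hx0)⁻¹ := hm
  obtain ⟨e, he⟩ := exists_zpow_cyclicDelta_mul_eq hq hγ hγ' (Units.mk0 l hl)
  have hr2 : hPoly F γ m = minpoly F x := by
    rw [hPoly, zpow_neg, hm, inv_inv, Units.val_mk0]
  have hint : IsIntegral F x := Algebra.IsIntegral.isIntegral x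
  have hassoc : Associated r (minpoly F x) :=
    ((minpoly.irreducible hint).associated_of_dvd hr (minpoly.dvd F x hx)).symm
  have hr1 : hPoly F γ (cyclicDelta q k * e) = X - C l⁻¹ := by
    rw [hPoly_eq_minpoly_of_units_map_eq he, Units.val_mk0, minpoly.eq_X_sub_C']
  have hxW : ∀ c ∈ W, aeval (rightShift F (q ^ k - 1)) (minpoly F x) c = 0 := by
    intro c hc
    obtain ⟨s, hs⟩ := hassoc.dvd
    rw [hs, mul_comm, map_mul, Module.End.mul_apply, hrW c hc, map_zero]
  have hxX : minpoly F x ∣ X ^ (q ^ k - 1) - 1 := minpoly.dvd F x (by simp [hpow x hx0])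
  -- At most k because x lies in K; at least k because the kernel contains W.
  have hdeg : (minpoly F x).natDegree = k := by
    refine le_antisymm (hK ▸ minpoly.natDegree_le x) ?_
    rw [← hWk]
    exact (Submodule.finrank_mono (fun c hc => hxW c hc)).trans (finrank_ker_aeval_rightShift_le hxX)
  have hlX : X - C l⁻¹ ∣ (X ^ (q ^ k - 1) - 1 : F[X]) := by
    rw [dvd_iff_isRoot, IsRoot.def]
    have h1 := hpow (algebraMap F K l⁻¹) (by simpa using hl)
    rw [← map_pow, ← map_one (algebraMap F K)] at h1
    simp [(algebraMap F K).injective h1]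
  have hlu : rightShift F (q ^ k - 1) u = l⁻¹ • u := by
    ext i
    have := hul (i - 1)
    rw [sub_add_cancel] at this
    rw [rightShift_apply, Pi.smul_apply, this, smul_eq_mul, inv_mul_cancel_left₀ hl]
  have hcopr : IsCoprime (X - C l⁻¹) (minpoly F x) := by
    rw [(irreducible_X_sub_C l⁻¹).coprime_iff_not_dvd]
    intro hd
    have := natDegree_eq_of_degree_eq (degree_eq_degree_of_associated
      ((irreducible_X_sub_C l⁻¹).associated_of_dvd
        (minpoly.irreducible hint) hd))
    rw [natDegree_X_sub_C, hdeg] at this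
    omega
  have hdvd : (X - C l⁻¹) * minpoly F x ∣ X ^ (q ^ k - 1) - 1 := hcopr.mul_dvd hlX hxX
  have hmonic : ((X - C l⁻¹) * minpoly F x).Monic :=
    (monic_X_sub_C _).mul (minpoly.monic hint)
  have hker : code =
      LinearMap.ker (aeval (rightShift F (q ^ k - 1)) ((X - C l⁻¹) * minpoly F x)) := by
    refine Submodule.eq_of_le_of_finrank_le (fun c hc => ?_) ?_
    · obtain ⟨a, ha⟩ := hWu c hc
      have h1 : aeval (rightShift F (q ^ k - 1)) (X - C l⁻¹) u = 0 := by simp [hlu]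
      rw [LinearMap.mem_ker, ← sub_add_cancel c (a • u), map_add, map_smul, map_mul,
        Module.End.mul_apply, hxW _ ha, ← map_mul, mul_comm, map_mul, Module.End.mul_apply, h1]
      simp
    · refine (finrank_ker_aeval_rightShift_le hdvd).trans ?_
      rw [(monic_X_sub_C _).natDegree_mul (minpoly.monic hint),
        natDegree_X_sub_C, hdeg, hdim, add_comm]
  refine ⟨e, m, ?_, ?_⟩
  · rw [hr1, hr2]
    exact isParityCheckPolynomial_of_mem_iff hmonic hdvd fun c => by rw [hker, LinearMap.mem_ker]
  · rw [← hγ]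
    -- Here θ = (xl)⁻¹. If θ^d = 1, then x^d = l^(-d) and S^d is scalar on the whole code, so the
    -- normalised coordinates at 0 and -d agree and n divides d.
    refine isCoprime_orderOf_of_forall (by omega) fun d hd => ?_
    have hxl : x ^ d = algebraMap F K (l⁻¹ ^ d) := by
      rw [zpow_sub, ← he, hm, mul_pow, mul_eq_one_iff_eq_inv] at hd
      have := congrArg Units.val hd
      simp only [inv_pow, inv_inv, Units.val_inv_eq_inv_val, Units.val_pow_eq_pow_val,
        Units.val_mk0, Units.coe_map, MonoidHom.coe_coe] at this
      rw [map_pow, map_inv₀, inv_pow, ← this, inv_inv]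
    have hmd : minpoly F x ∣ X ^ d - C (l⁻¹ ^ d) := minpoly.dvd F x (by simp [hxl])
    obtain ⟨s, hs⟩ := hmd
    have hkill : ∀ c ∈ code, (rightShift F (q ^ k - 1) ^ d) c = l⁻¹ ^ d • c := by
      intro c hc
      have hupow : (rightShift F (q ^ k - 1) ^ d) u = l⁻¹ ^ d • u := by
        clear hxl hs hd
        induction d with
        | zero => simp
        | succ d ih =>
          rw [pow_succ, Module.End.mul_apply, hlu, map_smul, ih, smul_smul, pow_succ, mul_comm]
      have hWpow : ∀ c ∈ W, (rightShift F (q ^ k - 1) ^ d) c = l⁻¹ ^ d • c := by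
        intro c hc
        have h1 : aeval (rightShift F (q ^ k - 1)) (X ^ d - C (l⁻¹ ^ d)) c = 0 := by
          rw [hs, mul_comm, map_mul, Module.End.mul_apply, hxW c hc, map_zero]
        rw [map_sub, aeval_X_pow, aeval_C, LinearMap.sub_apply, Module.algebraMap_end_apply,
          sub_eq_zero] at h1
        exact h1
      obtain ⟨a, ha⟩ := hWu c hc
      rw [← sub_add_cancel c (a • u), map_add, hWpow _ ha, map_smul, hupow, smul_add,
        smul_comm a]
    have h0 : (0 - Fin.ofNat (q ^ k - 1) d) = 0 := by
      refine hinj _ _ fun c hc => ?_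
      rw [← rightShift_pow_apply d c, ← rightShift_pow_apply d u, hkill c hc, hkill u huc,
        Pi.smul_apply, Pi.smul_apply, smul_eq_mul, smul_eq_mul,
        mul_div_mul_left _ _ (pow_ne_zero _ (inv_ne_zero hl))]
    rw [hγ]
    rw [zero_sub, neg_eq_zero, Fin.ext_iff] at h0
    exact Nat.dvd_of_mod_eq_zero h0

end Main

theorem theorem2 {F K : Type*} [Field F] [Finite F] [DecidableEq F] [Field K] [Algebra F K]
    (q k : ℕ) (hq : Nat.card F = q) (hk : 1 < k) (hK : Module.finrank F K = k)
    (γ : Kˣ) (hγ : ∀ x : Kˣ, x ∈ Subgroup.zpowers γ)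
    (code : Submodule F (Fin (q ^ k - 1) → F)) (hcode : IsCyclicCode code) :
    HasThreeWeightDistribution q k code ↔
      Module.finrank F code = k + 1 ∧
      ∃ e₁ e₂ : ℤ,
        IsParityCheckPolynomial code
          (hPoly F γ ((cyclicDelta q k : ℤ) * e₁) * hPoly F γ e₂) ∧
        Int.gcd ((q : ℤ) - 1) ((k : ℤ) * e₁ - e₂) = 1 ∧
        Int.gcd (cyclicDelta q k : ℤ) e₂ = 1 := by
  have : Module.Finite F K := Module.finite_of_finrank_pos (by omega)
  have hq1 : 1 < q := hq ▸ Finite.one_lt_card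
  have hord : orderOf γ = q ^ k - 1 := by
    rw [orderOf_eq_card_of_forall_mem_zpowers hγ, Nat.card_units,
      Module.natCard_eq_pow_finrank (K := F), hq, hK]
  simp only [← isCoprime_pow_sub_one_iff hq1]
  constructor
  · intro h
    exact ⟨h.finrank_eq hq hk,
      exists_isParityCheckPolynomial_of_hasThreeWeightDistribution hq hk hK hord hγ hcode h⟩
  · rintro ⟨hdim, e₁, e₂, hpar, hcop⟩
    exact hasThreeWeightDistribution_of_isParityCheckPolynomial hq hk hK hord hdim hpar hcop
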